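/- \textbf{Grid.} A hybrid AC/DC grid has buses $\mathcal V=\{1,\dots,N\}$, AC branches $\mathcal E=\{1,\dots,N_{\mathcal E}\}$ and DC branches $\mathcal D=\{1,\dots,N_{\mathcal D}\}$. AC branch $k$ has a source bus $s_k$ and a destination bus $t_k$; DC branch $l$ has a source bus $s'_l$ and a destination bus $t'_l$. AC branch $k$ has a series admittance $y_k\in\mathbb C$, shunt admittances $\hat y_k,\check y_k\in\mathbb C$ and voltage ratios $\hat\rho_k,\check\rho_k\in\mathbb C\setminus\{0\}$ at its source and its destination; put $\rho_k=\overline{\hat\rho_k}\,\check\rho_k$ and $$\hat\alpha_k=|\hat\rho_k|^2(y_k+\hat y_k),\quad \hat\beta_k=-\rho_ky_k,\quad \check\alpha_k=|\check\rho_k|^2(y_k+\check y_k),\quad \check\beta_k=-\overline{\rho_k}\,y_k .$$ Bus $n$ has a shunt admittance $\tilde y_n\in\mathbb C$, and DC branch $l$ has a loss factor $\eta_l\in[0,1)$. With standard basis vectors $e_i$ let $$\hat Y=\sum_k e_k(\hat\alpha_ke_{s_k}^T+\hat\beta_ke_{t_k}^T),\qquad \check Y=\sum_k e_k(\check\alpha_ke_{t_k}^T+\check\beta_ke_{s_k}^T),$$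 $$Y=\sum_n e_n\Big[\Big(\tilde y_n+\sum_{k:s_k=n}\hat\alpha_k+\sum_{k:t_k=n}\check\alpha_k\Big)e_n^T+\sum_{k:s_k=n}\hat\beta_ke_{t_k}^T+\sum_{k:t_k=n}\check\beta_ke_{s_k}^T\Big],$$ and $S_n=Y^He_ne_n^T$, $P_n=\tfrac12(S_n+S_n^H)$, $Q_n=\tfrac1{2i}(S_n-S_n^H)$, $h_n=\sum_{l:s'_l=n}e_l-\sum_{l:t'_l=n}(1-\eta_l)e_l$, $M_n=e_ne_n^T$, $\hat M_k=e_{s_k}e_{t_k}^T$. \textbf{OPF problem.} Given bounds $\underline V_n,\overline V_n$ (voltage), $\overline P_n,\overline Q_n$ (net injection, i.e. maximal generation minus load), $\hat I_k,\check I_k$ (current), $\underline\nu_k,\overline\nu_k$ (voltage drop), $\underline\delta_k,\overline\delta_k$ (voltage angle) and $\underline p,\overline p$ (DC flow), costs $\gamma_n$ and weights $w,\gamma_L$, minimize $v^HC_0v+c_0^Tp$ over $v\in\mathbb C^N$, $p\in\mathbb R^{N_{\mathcal D}}$ subject to the following constraints, for all $n\in\mathcal V$, $k\in\mathcal E$,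 $l\in\mathcal D$: - $v^HM_nv\le\overline V_n^2$ and $v^H(-M_n)v\le-\underline V_n^2$; - $v^HP_nv+h_n^Tp\le\overline P_n$ and $v^HQ_nv\le\overline Q_n$; - $v^H\hat Y^He_ke_k^T\hat Yv\le\hat I_k^2$ and $v^H\check Y^He_ke_k^T\check Yv\le\check I_k^2$; - $v^H\big((1+\underline\nu_k)^2M_{s_k}-M_{t_k}\big)v\le0$ and $v^H\big(M_{t_k}-(1+\overline\nu_k)^2M_{s_k}\big)v\le0$; - $v^H(-\hat M_k-\hat M_k^H)v\le0$, $v^H\big((\tan\underline\delta_k+i)\hat M_k+(\tan\underline\delta_k-i)\hat M_k^H\big)v\le0$ and $v^H\big(-(\tan\overline\delta_k+i)\hat M_k-(\tan\overline\delta_k-i)\hat M_k^H\big)v\le0$; - $p_l\le\overline p_l$ and $-p_l\le-\underline p_l$. Here $$C_0=w\sum_n\gamma_nP_n+\gamma_L\Big(\sum_k\tfrac12(L_k+L_k^H)+\sum_n\operatorname{Re}(\tilde y_n)M_n\Big),\qquad L_k=\hat Y^He_ke_{s_k}^T+\check Y^He_ke_{t_k}^T,$$ and $c_0=w\sum_n\gamma_nh_n+\gamma_L\sum_l\eta_le_l$.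 Write the $M=4N+7N_{\mathcal E}+2N_{\mathcal D}$ constraints as $v^HC_mv+c_m^Tp\le b_m$, $m=1,\dots,M$. The \emph{relaxed problem} is to minimize $\operatorname{tr}(C_0V)+c_0^Tp$ over Hermitian $V\in\mathbb C^{N\times N}$ and $p\in\mathbb R^{N_{\mathcal D}}$ subject to $V\succeq0$ and $\operatorname{tr}(C_mV)+c_m^Tp\le b_m$ for $m=1,\dots,M$. For $\Lambda\in\mathbb R_{\ge0}^M$ put $\Psi(\Lambda)=C_0+\sum_m\Lambda_mC_m$. \textbf{Requirements.} - No AC or DC branch is a self-loop, no two AC branches are parallel or antiparallel, and the undirected graph $\overline{\mathcal G}_{AC}$ on $\mathcal V$ with edges $\{s_k,t_k\}$, $k\in\mathcal E$, is a tree. - For all $k$: $\operatorname{Re}y_k\ge0$, $\operatorname{Re}y_k\ne0$, $\operatorname{Re}\hat y_k\ge0$, $\operatorname{Re}\check y_k\ge0$, $\operatorname{Im}y_k\le0$, $|\hat y_k|/|y_k|\le1$, $|\check y_k|/|y_k|\le1$ and $|\arg\rho_k|\le\pi/2$. - For all $k$: $\underline\delta_k<\overline\delta_k$, $-\pi/2<\underline\delta_k\le-\arg\rho_k\le\overline\delta_k<\pi/2$,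 $-1\le\underline\nu_k<\overline\nu_k$ and $\hat I_k,\check I_k>0$. - For all $n$ and $l$: $0\le\underline V_n<\overline V_n$, $\underline p_l,\overline p_l\ge0$ and $\gamma_n\ge0$; moreover $w\ge0$ and $\gamma_L>0$. \textbf{Theorem.} Let a hybrid AC/DC grid satisfy the requirements. (a) For every $\Lambda\in\mathbb R^M_{\ge0}$, the graph on $\mathcal V$ in which distinct $i,j$ are adjacent if and only if $[\Psi(\Lambda)]_{i,j}\ne0$ equals $\overline{\mathcal G}_{AC}$. If moreover $\Psi(\Lambda)\succeq0$, then $\operatorname{rank}\Psi(\Lambda)\ge N-1$. (b) Suppose in addition that there are $v\in\mathbb C^N$ and $p\in\mathbb R_{\ge0}^{N_{\mathcal D}}$ with $\underline p\le p\le\overline p$ that satisfy all other constraints of the OPF problem with strict inequality. Then the relaxed problem has an optimizer, and every optimizer $(V,p)$ of it satisfies $\operatorname{rank}V\le1$, with $\operatorname{rank}V=1$ whenever the OPF problem has no feasible point with $v=0$. Moreover $V=vv^H$ for some $v\in\mathbb C^N$, and for every such $v$ the pair $(v,p)$ is a global optimizer of the OPF problem. -/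

import Mathlib

open scoped Matrix ComplexOrder

noncomputable section

/-- The data of a hybrid AC/DC transmission grid with `N` buses, `E` AC branches and `D` DC branches,
together with the parameters of its optimal power flow problem. -/
structure HybridGrid (N E D : ℕ) where
  /-- source and destination bus of an AC branch -/
  acSrc : Fin E → Fin N
  acDst : Fin E → Fin N
  /-- source and destination bus of a DC branch -/
  dcSrc : Fin D → Fin N
  dcDst : Fin D → Fin N
  /-- series admittance of an AC branch -/
  y : Fin E → ℂ
  /-- shunt admittances of an AC branch, at its source and at its destination -/
  yOut : Fin E → ℂ
  yIn : Fin E → ℂ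
  /-- complex voltage ratios of an AC branch, at its source and at its destination -/
  rhoOut : Fin E → ℂ
  rhoIn : Fin E → ℂ
  /-- shunt admittance of a bus -/
  yShunt : Fin N → ℂ
  /-- loss factor of a DC branch -/
  eta : Fin D → ℝ
  /-- bounds on the voltage magnitude at a bus -/
  Vmin : Fin N → ℝ
  Vmax : Fin N → ℝ
  /-- bounds on the current magnitude at the source and the destination of an AC branch -/
  IoutMax : Fin E → ℝ
  IinMax : Fin E → ℝ
  /-- bounds on the power flow on a DC branch -/
  pMin : Fin D → ℝ
  pMax : Fin D → ℝ
  /-- bounds on the relative voltage magnitude drop along an AC branch -/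
  nuMin : Fin E → ℝ
  nuMax : Fin E → ℝ
  /-- bounds on the voltage angle difference along an AC branch -/
  deltaMin : Fin E → ℝ
  deltaMax : Fin E → ℝ
  /-- active and reactive load at a bus -/
  Pload : Fin N → ℝ
  Qload : Fin N → ℝ
  /-- upper limits on the active and reactive power generation at a bus -/
  PgenMax : Fin N → ℝ
  QgenMax : Fin N → ℝ
  /-- generation cost at a bus -/
  gamma : Fin N → ℝ
  /-- weight of the generation cost -/
  w : ℝ
  /-- weight of the electrical loss -/
  gammaLoss : ℝ

namespace HybridGrid

variable {N E D : ℕ} (G : HybridGrid N E D)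

/-! ### Architecture -/

/-- AC branches outgoing and incoming at a bus. -/
def acOut (n : Fin N) : Finset (Fin E) := Finset.univ.filter fun k => G.acSrc k = n
def acIn (n : Fin N) : Finset (Fin E) := Finset.univ.filter fun k => G.acDst k = n

/-- DC branches outgoing and incoming at a bus. -/
def dcOut (n : Fin N) : Finset (Fin D) := Finset.univ.filter fun l => G.dcSrc l = n
def dcIn (n : Fin N) : Finset (Fin D) := Finset.univ.filter fun l => G.dcDst l = n

/-- The undirected graph underlying the buses and AC branches. -/
def acGraph : SimpleGraph (Fin N) :=
  SimpleGraph.fromRel fun i j => ∃ k : Fin E, G.acSrc k = i ∧ G.acDst k = j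

/-! ### Electrical model -/

/-- Total voltage ratio of an AC branch. -/
def rho (k : Fin E) : ℂ := star (G.rhoOut k) * G.rhoIn k

def alphaOut (k : Fin E) : ℂ := ((‖G.rhoOut k‖ ^ 2 : ℝ) : ℂ) * (G.y k + G.yOut k)
def betaOut (k : Fin E) : ℂ := -(G.rho k * G.y k)
def alphaIn (k : Fin E) : ℂ := ((‖G.rhoIn k‖ ^ 2 : ℝ) : ℂ) * (G.y k + G.yIn k)
def betaIn (k : Fin E) : ℂ := -(star (G.rho k) * G.y k)

/-- Source admittance matrix. -/
def Yout : Matrix (Fin E) (Fin N) ℂ :=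
  ∑ k, (Matrix.single k (G.acSrc k) (G.alphaOut k) + Matrix.single k (G.acDst k) (G.betaOut k))

/-- Destination admittance matrix. -/
def Yin : Matrix (Fin E) (Fin N) ℂ :=
  ∑ k, (Matrix.single k (G.acDst k) (G.alphaIn k) + Matrix.single k (G.acSrc k) (G.betaIn k))

def alphaBus (n : Fin N) : ℂ :=
  G.yShunt n + ∑ k ∈ G.acOut n, G.alphaOut k + ∑ k ∈ G.acIn n, G.alphaIn k

/-- Bus admittance matrix. -/
def Y : Matrix (Fin N) (Fin N) ℂ :=
  ∑ n, (Matrix.single n n (G.alphaBus n)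
    + ∑ k ∈ G.acOut n, Matrix.single n (G.acDst k) (G.betaOut k)
    + ∑ k ∈ G.acIn n, Matrix.single n (G.acSrc k) (G.betaIn k))

def S (n : Fin N) : Matrix (Fin N) (Fin N) ℂ := G.Yᴴ * Matrix.single n n 1

/-- Active power injection at bus `n` into the AC subgrid, as a Hermitian form. -/
def P (n : Fin N) : Matrix (Fin N) (Fin N) ℂ := (1 / 2 : ℂ) • (G.S n + (G.S n)ᴴ)

/-- Reactive power injection at bus `n`, as a Hermitian form. -/
def Q (n : Fin N) : Matrix (Fin N) (Fin N) ℂ :=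
  (1 / (2 * Complex.I) : ℂ) • (G.S n - (G.S n)ᴴ)

/-- Active power injection at bus `n` into the DC branches, as a linear form. -/
def h (n : Fin N) : Fin D → ℝ :=
  ∑ l ∈ G.dcOut n, Pi.single l 1 - ∑ l ∈ G.dcIn n, (1 - G.eta l) • Pi.single l 1

/-! ### Constraint matrices -/

def Mbus (n : Fin N) : Matrix (Fin N) (Fin N) ℂ := Matrix.single n n 1

def Iout (k : Fin E) : Matrix (Fin N) (Fin N) ℂ := G.Youtᴴ * Matrix.single k k (1 : ℂ) * G.Yout
def Iin (k : Fin E) : Matrix (Fin N) (Fin N) ℂ := G.Yinᴴ * Matrix.single k k (1 : ℂ) * G.Yin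

def Mlb (k : Fin E) : Matrix (Fin N) (Fin N) ℂ :=
  (((1 + G.nuMin k) ^ 2 : ℝ) : ℂ) • Mbus (G.acSrc k) - Mbus (G.acDst k)
def Mub (k : Fin E) : Matrix (Fin N) (Fin N) ℂ :=
  Mbus (G.acDst k) - (((1 + G.nuMax k) ^ 2 : ℝ) : ℂ) • Mbus (G.acSrc k)

def Mout (k : Fin E) : Matrix (Fin N) (Fin N) ℂ := Matrix.single (G.acSrc k) (G.acDst k) 1

def A (k : Fin E) : Matrix (Fin N) (Fin N) ℂ := -G.Mout k - (G.Mout k)ᴴ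
def Alb (k : Fin E) : Matrix (Fin N) (Fin N) ℂ :=
  ((Real.tan (G.deltaMin k) : ℂ) + Complex.I) • G.Mout k
    + ((Real.tan (G.deltaMin k) : ℂ) - Complex.I) • (G.Mout k)ᴴ
def Aub (k : Fin E) : Matrix (Fin N) (Fin N) ℂ :=
  -((Real.tan (G.deltaMax k) : ℂ) + Complex.I) • G.Mout k
    - ((Real.tan (G.deltaMax k) : ℂ) - Complex.I) • (G.Mout k)ᴴ

/-! ### Objective -/

def Ccost : Matrix (Fin N) (Fin N) ℂ := ∑ n, (G.gamma n : ℂ) • G.P n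
def ccost : Fin D → ℝ := ∑ n, G.gamma n • G.h n

def Sloss (k : Fin E) : Matrix (Fin N) (Fin N) ℂ :=
  G.Youtᴴ * Matrix.single k (G.acSrc k) (1 : ℂ)
    + G.Yinᴴ * Matrix.single k (G.acDst k) (1 : ℂ)

def Ploss (k : Fin E) : Matrix (Fin N) (Fin N) ℂ := (1 / 2 : ℂ) • (G.Sloss k + (G.Sloss k)ᴴ)

def Closs : Matrix (Fin N) (Fin N) ℂ :=
  ∑ k, G.Ploss k + ∑ n, ((G.yShunt n).re : ℂ) • Mbus n
def closs : Fin D → ℝ := ∑ l, G.eta l • Pi.single l 1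

/-- The objective is `vᴴ C₀ v + c₀ᵀ p`, the weighted sum of generation cost and electrical loss
up to an additive constant. -/
def C0 : Matrix (Fin N) (Fin N) ℂ := (G.w : ℂ) • G.Ccost + (G.gammaLoss : ℂ) • G.Closs
def c0 : Fin D → ℝ := G.w • G.ccost + G.gammaLoss • G.closs

/-! ### The optimal power flow problem and its semidefinite relaxation -/

/-- The `M = 4 N + 7 E + 2 D` constraints. -/
inductive Con (N E D : ℕ) : Type
  | voltMax (n : Fin N)
  | voltMin (n : Fin N)
  | activeMax (n : Fin N)
  | reactiveMax (n : Fin N)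
  | currentOut (k : Fin E)
  | currentIn (k : Fin E)
  | dropMin (k : Fin E)
  | dropMax (k : Fin E)
  | angle (k : Fin E)
  | angleMin (k : Fin E)
  | angleMax (k : Fin E)
  | dcMax (l : Fin D)
  | dcMin (l : Fin D)
  deriving Fintype

/-- Constraint `m` reads `vᴴ Cₘ v + cₘᵀ p ≤ bₘ`. -/
def C : Con N E D → Matrix (Fin N) (Fin N) ℂ
  | .voltMax n => Mbus n
  | .voltMin n => -Mbus n
  | .activeMax n => G.P n
  | .reactiveMax n => G.Q n
  | .currentOut k => G.Iout k
  | .currentIn k => G.Iin k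
  | .dropMin k => G.Mlb k
  | .dropMax k => G.Mub k
  | .angle k => G.A k
  | .angleMin k => G.Alb k
  | .angleMax k => G.Aub k
  | .dcMax _ => 0
  | .dcMin _ => 0

def c : Con N E D → Fin D → ℝ
  | .activeMax n => G.h n
  | .dcMax l => Pi.single l 1
  | .dcMin l => -Pi.single l 1
  | _ => 0

def b : Con N E D → ℝ
  | .voltMax n => G.Vmax n ^ 2
  | .voltMin n => -G.Vmin n ^ 2
  | .activeMax n => G.PgenMax n - G.Pload n
  | .reactiveMax n => G.QgenMax n - G.Qload n
  | .currentOut k => G.IoutMax k ^ 2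
  | .currentIn k => G.IinMax k ^ 2
  | .dropMin _ => 0
  | .dropMax _ => 0
  | .angle _ => 0
  | .angleMin _ => 0
  | .angleMax _ => 0
  | .dcMax l => G.pMax l
  | .dcMin l => -G.pMin l

/-- The value `vᴴ A v` of a Hermitian form; it is real for Hermitian `A`. -/
def quad (A : Matrix (Fin N) (Fin N) ℂ) (v : Fin N → ℂ) : ℝ := (star v ⬝ᵥ A *ᵥ v).re

/-- Feasibility for the OPF problem. -/
def OPFFeasible (v : Fin N → ℂ) (p : Fin D → ℝ) : Prop :=
  ∀ m : Con N E D, quad (G.C m) v + G.c m ⬝ᵥ p ≤ G.b m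

/-- Global optimizers of the OPF problem. -/
def OPFOptimizer (v : Fin N → ℂ) (p : Fin D → ℝ) : Prop :=
  G.OPFFeasible v p ∧ ∀ v' p', G.OPFFeasible v' p' →
    quad G.C0 v + G.c0 ⬝ᵥ p ≤ quad G.C0 v' + G.c0 ⬝ᵥ p'

/-- Feasibility for the relaxed OPF problem (`Matrix.PosSemidef` includes being Hermitian). -/
def RelaxedFeasible (V : Matrix (Fin N) (Fin N) ℂ) (p : Fin D → ℝ) : Prop :=
  V.PosSemidef ∧ ∀ m : Con N E D, (G.C m * V).trace.re + G.c m ⬝ᵥ p ≤ G.b m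

/-- Optimizers of the relaxed OPF problem. -/
def RelaxedOptimizer (V : Matrix (Fin N) (Fin N) ℂ) (p : Fin D → ℝ) : Prop :=
  G.RelaxedFeasible V p ∧ ∀ V' p', G.RelaxedFeasible V' p' →
    (G.C0 * V).trace.re + G.c0 ⬝ᵥ p ≤ (G.C0 * V').trace.re + G.c0 ⬝ᵥ p'

/-- Essentially strict feasibility: all constraints hold strictly, except that the bounds on the DC
branch flows may hold with equality. -/
def EssentiallyStrictlyFeasible : Prop :=
  ∃ (v : Fin N → ℂ) (p : Fin D → ℝ), (∀ l, 0 ≤ p l) ∧ ∀ m : Con N E D,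
    match m with
    | .dcMax l => p l ≤ G.pMax l
    | .dcMin l => -p l ≤ -G.pMin l
    | m => quad (G.C m) v + G.c m ⬝ᵥ p < G.b m

/-! ### Requirements on the grid -/

/-- The requirements of the system model on the grid and its parameters. -/
structure Requirements : Prop where
  ac_no_loop : ∀ k, G.acSrc k ≠ G.acDst k
  dc_no_loop : ∀ l, G.dcSrc l ≠ G.dcDst l
  no_parallel : ∀ k₁ k₂, k₁ ≠ k₂ → ¬(G.acSrc k₁ = G.acSrc k₂ ∧ G.acDst k₁ = G.acDst k₂)
  no_antiparallel : ∀ k₁ k₂, k₁ ≠ k₂ → ¬(G.acSrc k₁ = G.acDst k₂ ∧ G.acDst k₁ = G.acSrc k₂)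
  tree : G.acGraph.IsTree
  rhoOut_ne : ∀ k, G.rhoOut k ≠ 0
  rhoIn_ne : ∀ k, G.rhoIn k ≠ 0
  eta_mem : ∀ l, G.eta l ∈ Set.Ico (0 : ℝ) 1
  /-- AC branches are passive with nonzero series conductance and inductive series susceptance. -/
  passive : ∀ k, 0 ≤ (G.y k).re
  passive_out : ∀ k, 0 ≤ (G.yOut k).re
  passive_in : ∀ k, 0 ≤ (G.yIn k).re
  conductance_ne : ∀ k, (G.y k).re ≠ 0
  inductive_series : ∀ k, (G.y k).im ≤ 0
  /-- AC branches are properly insulated. -/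
  insulated_out : ∀ k, ‖G.yOut k‖ / ‖G.y k‖ ≤ 1
  insulated_in : ∀ k, ‖G.yIn k‖ / ‖G.y k‖ ≤ 1
  /-- The total phase shift is at most 90 degrees. -/
  phase_shift : ∀ k, |(G.rho k).arg| ≤ Real.pi / 2
  Vmin_nonneg : ∀ n, 0 ≤ G.Vmin n
  Vmin_lt_Vmax : ∀ n, G.Vmin n < G.Vmax n
  IoutMax_pos : ∀ k, 0 < G.IoutMax k
  IinMax_pos : ∀ k, 0 < G.IinMax k
  pMin_nonneg : ∀ l, 0 ≤ G.pMin l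
  pMax_nonneg : ∀ l, 0 ≤ G.pMax l
  nuMin_ge : ∀ k, -1 ≤ G.nuMin k
  nuMin_lt_nuMax : ∀ k, G.nuMin k < G.nuMax k
  deltaMin_lt_deltaMax : ∀ k, G.deltaMin k < G.deltaMax k
  deltaMin_gt : ∀ k, -(Real.pi / 2) < G.deltaMin k
  deltaMin_le : ∀ k, G.deltaMin k ≤ -(G.rho k).arg
  deltaMax_ge : ∀ k, -(G.rho k).arg ≤ G.deltaMax k
  deltaMax_lt : ∀ k, G.deltaMax k < Real.pi / 2
  gamma_nonneg : ∀ n, 0 ≤ G.gamma n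
  w_nonneg : 0 ≤ G.w
  gammaLoss_pos : 0 < G.gammaLoss

/-! ### The dual matrix and its graph -/

/-- `Ψ(Λ) = C₀ + ∑ₘ Λₘ Cₘ`. -/
def Psi (Λ : Con N E D → ℝ) : Matrix (Fin N) (Fin N) ℂ := G.C0 + ∑ m, (Λ m : ℂ) • G.C m

lemma isHermitian_real_smul {A : Matrix (Fin N) (Fin N) ℂ} (hA : A.IsHermitian) (r : ℝ) :
    ((r : ℂ) • A).IsHermitian := by
  rw [Matrix.IsHermitian, Matrix.conjTranspose_smul, hA.eq]
  simp

lemma isHermitian_finset_sum {ι : Type} (s : Finset ι) {f : ι → Matrix (Fin N) (Fin N) ℂ}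
    (hf : ∀ i ∈ s, (f i).IsHermitian) : (∑ i ∈ s, f i).IsHermitian := by
  rw [Matrix.IsHermitian, Matrix.conjTranspose_sum]
  exact Finset.sum_congr rfl fun i hi => (hf i hi).eq

lemma Mbus_isHermitian (n : Fin N) : (Mbus n).IsHermitian := by
  simp [Matrix.IsHermitian, Mbus]

lemma P_isHermitian (n : Fin N) : (G.P n).IsHermitian := by
  simp [Matrix.IsHermitian, P, add_comm]

lemma Ploss_isHermitian (k : Fin E) : (G.Ploss k).IsHermitian := by
  simp only [Matrix.IsHermitian, Ploss, Matrix.conjTranspose_smul, Matrix.conjTranspose_add,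
    Matrix.conjTranspose_conjTranspose]
  rw [add_comm (G.Sloss k)ᴴ]
  simp

lemma C_isHermitian (m : Con N E D) : (G.C m).IsHermitian := by
  cases m with
  | voltMax n => exact Mbus_isHermitian n
  | voltMin n => exact (Mbus_isHermitian n).neg
  | activeMax n => exact G.P_isHermitian n
  | reactiveMax n =>
    simp only [C, Q, Matrix.IsHermitian, Matrix.conjTranspose_smul, Matrix.conjTranspose_sub,
      Matrix.conjTranspose_conjTranspose]
    rw [← neg_sub (G.S n), smul_neg, ← neg_smul]
    congr 1
    simp
  | currentOut k =>
    simp [C, Iout, Matrix.IsHermitian, Matrix.conjTranspose_mul, Matrix.mul_assoc]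
  | currentIn k =>
    simp [C, Iin, Matrix.IsHermitian, Matrix.conjTranspose_mul, Matrix.mul_assoc]
  | dropMin k =>
    exact (isHermitian_real_smul (Mbus_isHermitian _) _).sub (Mbus_isHermitian _)
  | dropMax k =>
    exact (Mbus_isHermitian _).sub (isHermitian_real_smul (Mbus_isHermitian _) _)
  | angle k =>
    simp only [C, A, Matrix.IsHermitian, Matrix.conjTranspose_sub, Matrix.conjTranspose_neg,
      Matrix.conjTranspose_conjTranspose]
    abel
  | angleMin k =>
    simp only [C, Alb, Matrix.IsHermitian, Matrix.conjTranspose_add, Matrix.conjTranspose_smul,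
      Matrix.conjTranspose_conjTranspose]
    rw [add_comm]
    simp [-Complex.ofReal_tan, sub_eq_add_neg]
  | angleMax k =>
    simp only [C, Aub, Matrix.IsHermitian, Matrix.conjTranspose_sub, Matrix.conjTranspose_smul,
      Matrix.conjTranspose_conjTranspose, neg_smul, Matrix.conjTranspose_neg]
    rw [sub_eq_add_neg, add_comm, ← sub_eq_add_neg]
    simp [-Complex.ofReal_tan, sub_eq_add_neg]
  | dcMax l => exact Matrix.isHermitian_zero
  | dcMin l => exact Matrix.isHermitian_zero

lemma C0_isHermitian : G.C0.IsHermitian := by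
  refine (isHermitian_real_smul ?_ _).add (isHermitian_real_smul (Matrix.IsHermitian.add ?_ ?_) _)
  · exact isHermitian_finset_sum _ fun n _ => isHermitian_real_smul (G.P_isHermitian n) _
  · exact isHermitian_finset_sum _ fun k _ => G.Ploss_isHermitian k
  · exact isHermitian_finset_sum _ fun n _ => isHermitian_real_smul (Mbus_isHermitian n) _

lemma Psi_isHermitian (Λ : Con N E D → ℝ) : (G.Psi Λ).IsHermitian :=
  G.C0_isHermitian.add
    (isHermitian_finset_sum _ fun m _ => isHermitian_real_smul (G.C_isHermitian m) _)

/-- The graph associated with a Hermitian matrix: distinct `i`, `j` are adjacent exactly when the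
entry at `(i, j)` is nonzero. -/
def associatedGraph (A : Matrix (Fin N) (Fin N) ℂ) (hA : A.IsHermitian) :
    SimpleGraph (Fin N) where
  Adj i j := A i j ≠ 0 ∧ i ≠ j
  symm := ⟨fun i j hij => ⟨by rw [← hA.apply]; simpa using hij.1, hij.2.symm⟩⟩
  loopless := ⟨fun _ hi => hi.2 rfl⟩

end HybridGrid

end

namespace HybridGrid

variable {N E D : ℕ} (G : HybridGrid N E D)

/-! The relaxation is exact because the dual matrices of a tree network have corank at most one.

On branch k, every constraint matrix has its (source, destination) entry in the closed half-plane
Re(-conj(ρ_k) z) ≥ 0 (`slant_C_nonneg`); passivity, inductive series susceptance, insulation and the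
angle bounds put it there. The loss term moves the entry of C₀ strictly inside (`slant_C0_pos`).
Nonnegative multipliers therefore cannot cancel a branch entry, while off-diagonal entries away from
branches vanish, so Ψ(Λ) has the AC tree as its graph (`associatedGraph_Psi`).

If a positive semidefinite matrix has a tree as its graph, a kernel vector that vanishes at one
vertex vanishes at its neighbors: each edge is a bridge, and the vector cut off on one side of it is
still in the kernel. The kernel then embeds into ℂ by evaluation at one vertex
(`le_rank_add_one_of_isTree`).

For an optimizer (V, p), convex duality gives Λ ≥ 0 with Ψ(Λ) ⪰ 0 and Ψ(Λ)V = 0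
(`RelaxedOptimizer.exists_dual`). The two ranks add up to at most N, so V has rank at most one and
equals vvᴴ. Feasible points of the OPF problem embed into the relaxed problem with the same
objective value, so (v, p) is globally optimal. -/

variable {G} in
lemma acGraph_adj_iff (hG : G.Requirements) (i j : Fin N) : G.acGraph.Adj i j ↔
    ∃ k, (G.acSrc k = i ∧ G.acDst k = j) ∨ (G.acSrc k = j ∧ G.acDst k = i) := by
  simp only [acGraph, SimpleGraph.fromRel_adj, ← exists_or]
  refine ⟨fun h => h.2, fun ⟨k, hk⟩ => ⟨?_, k, hk⟩⟩
  have := hG.ac_no_loop k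
  rintro rfl
  rcases hk with ⟨h₁, h₂⟩ | ⟨h₁, h₂⟩ <;> exact this (h₁.trans h₂.symm)

variable {G} in
lemma Requirements.eq_of_same_ends (hG : G.Requirements) {k k' : Fin E}
    (hs : G.acSrc k' = G.acSrc k) (ht : G.acDst k' = G.acDst k) : k' = k := by
  by_contra hne
  exact hG.no_parallel k' k hne ⟨hs, ht⟩

-- Together with `Requirements.eq_of_same_ends`, this leaves one branch, in one orientation, on each
-- edge, so the sums over branches in `Y_src_dst` and `Y_dst_src` collapse to one term. The case k'
-- = k is excluded by the absence of self-loops.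
variable {G} in
lemma Requirements.not_reversed (hG : G.Requirements) {k k' : Fin E}
    (hs : G.acSrc k' = G.acDst k) (ht : G.acDst k' = G.acSrc k) : False := by
  by_cases hne : k' = k
  · subst hne
    exact hG.ac_no_loop _ hs
  · exact hG.no_antiparallel k' k hne ⟨hs, ht⟩

/-! ### Entries of the grid matrices -/

lemma Yout_apply (k : Fin E) (a : Fin N) : G.Yout k a =
    (if G.acSrc k = a then G.alphaOut k else 0) + if G.acDst k = a then G.betaOut k else 0 := by
  simp [Yout, Matrix.sum_apply, Matrix.single_apply, Finset.sum_add_distrib, ite_and]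

lemma Yin_apply (k : Fin E) (a : Fin N) : G.Yin k a =
    (if G.acDst k = a then G.alphaIn k else 0) + if G.acSrc k = a then G.betaIn k else 0 := by
  simp [Yin, Matrix.sum_apply, Matrix.single_apply, Finset.sum_add_distrib, ite_and]

lemma Y_apply_of_ne {i j : Fin N} (hij : i ≠ j) : G.Y i j =
    ∑ k, ((if G.acSrc k = i ∧ G.acDst k = j then G.betaOut k else 0)
      + if G.acDst k = i ∧ G.acSrc k = j then G.betaIn k else 0) := by
  rw [Y, Matrix.sum_apply, Finset.sum_eq_single i]
  · simp only [Matrix.add_apply, Matrix.sum_apply, Matrix.single_apply]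
    simp [hij, acOut, acIn, Finset.sum_filter, Finset.sum_add_distrib, ite_and]
  · intro n _ hn
    simp [Matrix.sum_apply, hn]
  · simp

lemma S_apply (n i j : Fin N) : G.S n i j = if n = j then star (G.Y n i) else 0 := by
  simp [S, Matrix.mul_apply, Matrix.single_apply, ite_and]

lemma P_apply (n i j : Fin N) : G.P n i j =
    (1 / 2) * ((if n = j then star (G.Y n i) else 0) + if n = i then G.Y n j else 0) := by
  simp only [P, Matrix.smul_apply, Matrix.add_apply, Matrix.conjTranspose_apply, S_apply,
    smul_eq_mul]
  split_ifs <;> simp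

lemma Q_apply (n i j : Fin N) : G.Q n i j = (1 / (2 * Complex.I)) *
    ((if n = j then star (G.Y n i) else 0) - if n = i then G.Y n j else 0) := by
  simp only [Q, Matrix.smul_apply, Matrix.sub_apply, Matrix.conjTranspose_apply, S_apply,
    smul_eq_mul]
  split_ifs <;> simp

lemma Mbus_apply_of_ne (n : Fin N) {i j : Fin N} (hij : i ≠ j) : Mbus n i j = 0 := by
  rw [Mbus, Matrix.single_apply, if_neg]
  rintro ⟨rfl, rfl⟩
  exact hij rfl

lemma Iout_apply (k : Fin E) (i j : Fin N) :
    G.Iout k i j = star (G.Yout k i) * G.Yout k j := by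
  simp [Iout, Matrix.mul_apply, Matrix.single_apply, ite_and]

lemma Iin_apply (k : Fin E) (i j : Fin N) :
    G.Iin k i j = star (G.Yin k i) * G.Yin k j := by
  simp [Iin, Matrix.mul_apply, Matrix.single_apply, ite_and]

lemma Mout_apply (k : Fin E) (i j : Fin N) :
    G.Mout k i j = if G.acSrc k = i ∧ G.acDst k = j then 1 else 0 := by
  rw [Mout, Matrix.single_apply]

lemma Sloss_apply (k : Fin E) (i j : Fin N) : G.Sloss k i j =
    (if G.acSrc k = j then star (G.Yout k i) else 0)
      + if G.acDst k = j then star (G.Yin k i) else 0 := by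
  simp [Sloss, Matrix.mul_apply, Matrix.single_apply, ite_and]

lemma Ploss_apply (k : Fin E) (i j : Fin N) : G.Ploss k i j =
    (1 / 2) * (G.Sloss k i j + star (G.Sloss k j i)) := by
  simp [Ploss]

/-! ### Off-diagonal entries vanish away from the AC branches -/

section Sparsity

variable {G} {i j : Fin N}

lemma Y_apply_of_not_adj (hG : G.Requirements) (hij : i ≠ j) (h : ¬G.acGraph.Adj i j) :
    G.Y i j = 0 := by
  rw [acGraph_adj_iff hG] at h
  rw [G.Y_apply_of_ne hij]
  refine Finset.sum_eq_zero fun k _ => ?_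
  rw [if_neg fun hk => h ⟨k, .inl hk⟩, if_neg fun hk => h ⟨k, .inr hk.symm⟩, add_zero]

/-- The ends of a branch that is not between `i` and `j` miss one of these buses. -/
lemma ends_of_not_between {k : Fin E} (hij : i ≠ j)
    (h : ¬((G.acSrc k = i ∧ G.acDst k = j) ∨ (G.acSrc k = j ∧ G.acDst k = i))) :
    (G.acSrc k ≠ i ∧ G.acDst k ≠ i) ∨ (G.acSrc k ≠ j ∧ G.acDst k ≠ j) := by
  grind

lemma branch_apply_of_not_between {k : Fin E} (hij : i ≠ j)
    (h : ¬((G.acSrc k = i ∧ G.acDst k = j) ∨ (G.acSrc k = j ∧ G.acDst k = i))) :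
    G.Iout k i j = 0 ∧ G.Iin k i j = 0 ∧ G.Mout k i j = 0 ∧ G.Mout k j i = 0 ∧
      G.Ploss k i j = 0 := by
  have h1 := ends_of_not_between hij h
  rw [Iout_apply, Iin_apply, Mout_apply, Mout_apply, Ploss_apply, Sloss_apply, Sloss_apply,
    Yout_apply, Yin_apply, Yout_apply, Yin_apply]
  rcases h1 with ⟨h1, h2⟩ | ⟨h1, h2⟩ <;> simp [h1, h2]

/-- Power matrices inherit the pattern of Y, voltage and drop matrices are diagonal, and current and
angle matrices are supported on the two ends of a single branch. -/
lemma C_apply_of_not_adj (hG : G.Requirements) (hij : i ≠ j) (h : ¬G.acGraph.Adj i j)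
    (m : Con N E D) : G.C m i j = 0 := by
  have hY := Y_apply_of_not_adj hG hij h
  have hY' := Y_apply_of_not_adj hG hij.symm fun h' => h h'.symm
  have hbr (k : Fin E) := branch_apply_of_not_between (k := k) hij
    fun hk => h ((acGraph_adj_iff hG i j).2 ⟨k, hk⟩)
  cases m with
  | voltMax n => exact Mbus_apply_of_ne n hij
  | voltMin n => simp [C, Mbus_apply_of_ne n hij]
  | activeMax n =>
    rw [C, P_apply]
    split_ifs <;> simp_all
  | reactiveMax n =>
    rw [C, Q_apply]
    split_ifs <;> simp_all
  | currentOut k => exact (hbr k).1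
  | currentIn k => exact (hbr k).2.1
  | dropMin k => simp [C, Mlb, Mbus_apply_of_ne _ hij]
  | dropMax k => simp [C, Mub, Mbus_apply_of_ne _ hij]
  | angle k => simp [C, A, (hbr k).2.2.1, (hbr k).2.2.2.1]
  | angleMin k => simp [C, Alb, (hbr k).2.2.1, (hbr k).2.2.2.1]
  | angleMax k => simp [C, Aub, (hbr k).2.2.1, (hbr k).2.2.2.1]
  | dcMax l => rfl
  | dcMin l => rfl

lemma C0_apply_of_ne (hij : i ≠ j) : G.C0 i j =
    G.w * ∑ n, (G.gamma n : ℂ) * G.P n i j + G.gammaLoss * ∑ k, G.Ploss k i j := by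
  simp [C0, Ccost, Closs, Matrix.sum_apply, Mbus_apply_of_ne _ hij]

lemma C0_apply_of_not_adj (hG : G.Requirements) (hij : i ≠ j) (h : ¬G.acGraph.Adj i j) :
    G.C0 i j = 0 := by
  have hP (n : Fin N) : G.P n i j = 0 := C_apply_of_not_adj hG hij h (.activeMax n)
  have hL (k : Fin E) : G.Ploss k i j = 0 := (branch_apply_of_not_between (k := k) hij
    fun hk => h ((acGraph_adj_iff hG i j).2 ⟨k, hk⟩)).2.2.2.2
  simp [C0_apply_of_ne hij, hP, hL]

end Sparsity

/-! ### The entries on the AC branches lie in a common open half-plane -/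

section HalfPlane

variable {G} (k : Fin E)

lemma Y_src_dst (hG : G.Requirements) : G.Y (G.acSrc k) (G.acDst k) = G.betaOut k := by
  rw [G.Y_apply_of_ne (hG.ac_no_loop k), Finset.sum_eq_single k]
  · simp [hG.ac_no_loop k]
  · intro k' _ hk'
    rw [if_neg fun h => hk' (hG.eq_of_same_ends h.1 h.2),
      if_neg fun h => hG.not_reversed h.2 h.1, add_zero]
  · simp

lemma Y_dst_src (hG : G.Requirements) : G.Y (G.acDst k) (G.acSrc k) = G.betaIn k := by
  rw [G.Y_apply_of_ne (hG.ac_no_loop k).symm, Finset.sum_eq_single k]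
  · simp [hG.ac_no_loop k]
  · intro k' _ hk'
    rw [if_neg fun h => hG.not_reversed h.1 h.2,
      if_neg fun h => hk' (hG.eq_of_same_ends h.2 h.1), add_zero]
  · simp

lemma not_between_ends (hG : G.Requirements) {k' : Fin E} (hk' : k' ≠ k) :
    ¬((G.acSrc k' = G.acSrc k ∧ G.acDst k' = G.acDst k) ∨
      (G.acSrc k' = G.acDst k ∧ G.acDst k' = G.acSrc k)) := by
  rintro (h | h)
  · exact hk' (hG.eq_of_same_ends h.1 h.2)
  · exact hG.not_reversed h.1 h.2

variable (G) in
/-- The component of the `(acSrc k, acDst k)` entry along `-rho k`. -/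
def slant (B : Matrix (Fin N) (Fin N) ℂ) : ℝ :=
  (-(star (G.rho k)) * B (G.acSrc k) (G.acDst k)).re

lemma slant_add (B B' : Matrix (Fin N) (Fin N) ℂ) :
    G.slant k (B + B') = G.slant k B + G.slant k B' := by
  simp only [slant, Matrix.add_apply, mul_add, Complex.add_re]

lemma slant_smul (r : ℝ) (B : Matrix (Fin N) (Fin N) ℂ) :
    G.slant k ((r : ℂ) • B) = r * G.slant k B := by
  simp only [slant, Matrix.smul_apply, smul_eq_mul]
  rw [mul_left_comm, Complex.re_ofReal_mul]

lemma slant_sum {ι : Type} (s : Finset ι) (B : ι → Matrix (Fin N) (Fin N) ℂ) :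
    G.slant k (∑ i ∈ s, B i) = ∑ i ∈ s, G.slant k (B i) := by
  simp only [slant, Matrix.sum_apply, Finset.mul_sum, Complex.re_sum]

lemma slant_Mbus (hG : G.Requirements) (n : Fin N) : G.slant k (Mbus n) = 0 := by
  simp [slant, Mbus_apply_of_ne n (hG.ac_no_loop k)]

lemma re_rho_nonneg (hG : G.Requirements) : 0 ≤ (G.rho k).re :=
  Complex.abs_arg_le_pi_div_two_iff.1 (hG.phase_shift k)

/-- The real part is at least |a|² - |a||b|. With a the series and b a shunt admittance, this is
where insulation enters. -/
lemma re_mul_add_nonneg {a b : ℂ} (h : ‖b‖ / ‖a‖ ≤ 1) : 0 ≤ (a * star (a + b)).re := by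
  -- For a = 0 the quotient is 0 by convention and says nothing about b, but the product vanishes
  -- anyway.
  rcases eq_or_ne a 0 with rfl | ha
  · simp
  have hb : ‖b‖ ≤ ‖a‖ := (div_le_one (norm_pos_iff.2 ha)).1 h
  have h1 : (a * star (a + b)).re = ‖a‖ ^ 2 + (a * star b).re := by
    rw [star_add, mul_add, Complex.add_re, Complex.star_def, Complex.mul_conj']
    norm_cast
  have h2 : |(a * star b).re| ≤ ‖a‖ * ‖b‖ :=
    (Complex.abs_re_le_norm _).trans (by simp)
  rw [h1]
  nlinarith [neg_le_of_abs_le h2, norm_nonneg a]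

/-- Addition formula for the sine. It reduces the sign of the angle-bound entries to the position of
δ relative to -arg ρ. -/
lemma re_mul_tan_add_im (z : ℂ) {δ : ℝ} (h : 0 < Real.cos δ) :
    z.re * Real.tan δ + z.im = ‖z‖ * Real.sin (δ + z.arg) / Real.cos δ := by
  rw [Real.sin_add, Real.tan_eq_sin_div_cos]
  conv_lhs => rw [← Complex.norm_mul_cos_arg z, ← Complex.norm_mul_sin_arg z]
  field_simp

/-- The entry is -ρy/2 at the source, -ρ·conj(y)/2 at the destination and 0 at other buses, so its
component along -ρ is a nonnegative multiple of Re y. -/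
lemma slant_P_nonneg (hG : G.Requirements) (n : Fin N) : 0 ≤ G.slant k (G.P n) := by
  have hne := hG.ac_no_loop k
  have hy := hG.passive k
  rw [slant, P_apply]
  by_cases h1 : n = G.acDst k
  · subst h1
    rw [if_pos rfl, if_neg hne.symm, Y_dst_src k hG, betaIn]
    have : -star (G.rho k) * (1 / 2 * (star (-(star (G.rho k) * G.y k)) + 0)) =
      ((‖G.rho k‖ ^ 2 / 2 : ℝ) : ℂ) * star (G.y k) := by
      push_cast
      rw [← Complex.conj_mul']
      simp
      ring
    rw [this, Complex.re_ofReal_mul]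
    simp only [Complex.star_def, Complex.conj_re]
    positivity
  by_cases h2 : n = G.acSrc k
  · subst h2
    rw [if_pos rfl, if_neg hne, Y_src_dst k hG, betaOut]
    have : -star (G.rho k) * (1 / 2 * (0 + -(G.rho k * G.y k))) =
      ((‖G.rho k‖ ^ 2 / 2 : ℝ) : ℂ) * G.y k := by
      push_cast
      rw [← Complex.conj_mul']
      simp
      ring
    rw [this, Complex.re_ofReal_mul]
    positivity
  · simp [h1, h2]

/-- As for active power, but the factor 1/(2i) replaces Re y by -Im y, which is nonnegative for
inductive branches. -/
lemma slant_Q_nonneg (hG : G.Requirements) (n : Fin N) : 0 ≤ G.slant k (G.Q n) := by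
  have hne := hG.ac_no_loop k
  have hy : 0 ≤ -(G.y k).im := by linarith [hG.inductive_series k]
  have hI : (1 / (2 * Complex.I) : ℂ) = -Complex.I / 2 := by
    rw [one_div, mul_inv, Complex.inv_I]
    ring
  rw [slant, Q_apply, hI]
  by_cases h1 : n = G.acDst k
  · subst h1
    rw [if_pos rfl, if_neg hne.symm, Y_dst_src k hG, betaIn]
    have : -star (G.rho k) * (-Complex.I / 2 * (star (-(star (G.rho k) * G.y k)) - 0)) =
      ((‖G.rho k‖ ^ 2 / 2 : ℝ) : ℂ) * (-Complex.I * star (G.y k)) := by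
      push_cast
      rw [← Complex.conj_mul']
      simp
      ring
    rw [this, Complex.re_ofReal_mul]
    have : (-Complex.I * star (G.y k)).re = -(G.y k).im := by simp
    rw [this]
    positivity
  by_cases h2 : n = G.acSrc k
  · subst h2
    rw [if_pos rfl, if_neg hne, Y_src_dst k hG, betaOut]
    have : -star (G.rho k) * (-Complex.I / 2 * (0 - -(G.rho k * G.y k))) =
      ((‖G.rho k‖ ^ 2 / 2 : ℝ) : ℂ) * (Complex.I * G.y k) := by
      push_cast
      rw [← Complex.conj_mul']
      simp
      ring
    rw [this, Complex.re_ofReal_mul]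
    have : (Complex.I * G.y k).re = -(G.y k).im := by simp
    rw [this]
    positivity
  · simp [h1, h2]

lemma slant_Iout_nonneg (hG : G.Requirements) (k' : Fin E) : 0 ≤ G.slant k (G.Iout k') := by
  have hne := hG.ac_no_loop k
  by_cases hk : k' = k
  · subst hk
    rw [slant, Iout_apply, Yout_apply, Yout_apply, if_pos rfl, if_neg hne.symm, if_neg hne,
      if_pos rfl, alphaOut, betaOut]
    have : -star (G.rho k') * (star (((‖G.rhoOut k'‖ ^ 2 : ℝ) : ℂ) * (G.y k' + G.yOut k') + 0) *
        (0 + -(G.rho k' * G.y k'))) =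
      ((‖G.rho k'‖ ^ 2 * ‖G.rhoOut k'‖ ^ 2 : ℝ) : ℂ) * (G.y k' * star (G.y k' + G.yOut k')) := by
      push_cast
      rw [← Complex.conj_mul' (G.rho k')]
      simp
      ring
    rw [this, Complex.re_ofReal_mul]
    have := re_mul_add_nonneg (hG.insulated_out k')
    positivity
  · rw [slant, (branch_apply_of_not_between hne (not_between_ends k hG hk)).1]
    simp

lemma slant_Iin_nonneg (hG : G.Requirements) (k' : Fin E) : 0 ≤ G.slant k (G.Iin k') := by
  have hne := hG.ac_no_loop k
  by_cases hk : k' = k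
  · subst hk
    rw [slant, Iin_apply, Yin_apply, Yin_apply, if_pos rfl, if_neg hne.symm, if_neg hne,
      if_pos rfl, alphaIn, betaIn]
    have : -star (G.rho k') * (star (0 + -(star (G.rho k') * G.y k')) *
        (((‖G.rhoIn k'‖ ^ 2 : ℝ) : ℂ) * (G.y k' + G.yIn k') + 0)) =
      ((‖G.rho k'‖ ^ 2 * ‖G.rhoIn k'‖ ^ 2 : ℝ) : ℂ) *
        star (G.y k' * star (G.y k' + G.yIn k')) := by
      push_cast
      rw [← Complex.conj_mul' (G.rho k')]
      simp
      ring
    rw [this, Complex.re_ofReal_mul, Complex.star_def, Complex.conj_re]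
    have := re_mul_add_nonneg (hG.insulated_in k')
    positivity
  · rw [slant, (branch_apply_of_not_between hne (not_between_ends k hG hk)).2.1]
    simp

lemma Mout_src_dst : G.Mout k (G.acSrc k) (G.acDst k) = 1 := by
  simp [Mout_apply]

lemma Mout_dst_src (hG : G.Requirements) : G.Mout k (G.acDst k) (G.acSrc k) = 0 := by
  simp [Mout_apply, hG.ac_no_loop k]

lemma slant_C_nonneg (hG : G.Requirements) (m : Con N E D) : 0 ≤ G.slant k (G.C m) := by
  have hne := hG.ac_no_loop k
  have hoff {k' : Fin E} (hk : k' ≠ k) := branch_apply_of_not_between hne (not_between_ends k hG hk)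
  have hπ := abs_le.1 (hG.phase_shift k)
  cases m with
  | voltMax n => exact (slant_Mbus k hG n).ge
  | voltMin n => simp [C, slant, Mbus_apply_of_ne n hne]
  | activeMax n => exact slant_P_nonneg k hG n
  | reactiveMax n => exact slant_Q_nonneg k hG n
  | currentOut k' => exact slant_Iout_nonneg k hG k'
  | currentIn k' => exact slant_Iin_nonneg k hG k'
  | dropMin k' => simp [C, slant, Mlb, Mbus_apply_of_ne _ hne]
  | dropMax k' => simp [C, slant, Mub, Mbus_apply_of_ne _ hne]
  | angle k' =>
    by_cases hk : k' = k
    · subst hk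
      simpa [C, slant, A, Mout_src_dst, Mout_dst_src k' hG] using re_rho_nonneg k' hG
    · simp [C, slant, A, (hoff hk).2.2.1, (hoff hk).2.2.2.1]
  | angleMin k' =>
    by_cases hk : k' = k
    · subst hk
      have hcos : 0 < Real.cos (G.deltaMin k') := Real.cos_pos_of_mem_Ioo
        ⟨hG.deltaMin_gt k', (hG.deltaMin_lt_deltaMax k').trans (hG.deltaMax_lt k')⟩
      -- The sum of angles lies in [-π, 0]: the lower bound combines δ > -π/2 with arg ρ ≥ -π/2.
      have hsin : Real.sin (G.deltaMin k' + (G.rho k').arg) ≤ 0 :=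
        Real.sin_nonpos_of_nonpos_of_neg_pi_le (by linarith [hG.deltaMin_le k'])
          (by linarith [hG.deltaMin_gt k'])
      have h1 : (G.rho k').re * Real.tan (G.deltaMin k') + (G.rho k').im ≤ 0 := by
        rw [re_mul_tan_add_im _ hcos]
        exact div_nonpos_of_nonpos_of_nonneg
          (mul_nonpos_of_nonneg_of_nonpos (norm_nonneg _) hsin) hcos.le
      simp [C, slant, Alb, Mout_src_dst, Mout_dst_src k' hG, -Complex.ofReal_tan]
      linarith
    · simp [C, slant, Alb, (hoff hk).2.2.1, (hoff hk).2.2.2.1]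
  | angleMax k' =>
    by_cases hk : k' = k
    · subst hk
      have hcos : 0 < Real.cos (G.deltaMax k') := Real.cos_pos_of_mem_Ioo
        ⟨(hG.deltaMin_gt k').trans (hG.deltaMin_lt_deltaMax k'), hG.deltaMax_lt k'⟩
      have hsin : 0 ≤ Real.sin (G.deltaMax k' + (G.rho k').arg) :=
        Real.sin_nonneg_of_nonneg_of_le_pi (by linarith [hG.deltaMax_ge k'])
          (by linarith [hG.deltaMax_lt k'])
      have h1 : 0 ≤ (G.rho k').re * Real.tan (G.deltaMax k') + (G.rho k').im := by
        rw [re_mul_tan_add_im _ hcos]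
        positivity
      simp [C, slant, Aub, Mout_src_dst, Mout_dst_src k' hG, -Complex.ofReal_tan]
      linarith
    · simp [C, slant, Aub, (hoff hk).2.2.1, (hoff hk).2.2.2.1]
  | dcMax l => simp [C, slant]
  | dcMin l => simp [C, slant]

lemma slant_Ploss_self (hG : G.Requirements) :
    G.slant k (G.Ploss k) = ‖G.rho k‖ ^ 2 * (G.y k).re := by
  have hne := hG.ac_no_loop k
  simp only [slant, Ploss_apply, Sloss_apply, Yout_apply, Yin_apply, if_pos, if_neg hne,
    if_neg hne.symm, betaIn, betaOut]
  have : -star (G.rho k) * (1 / 2 * ((0 + star (0 + -(star (G.rho k) * G.y k))) +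
      star (star (0 + -(G.rho k * G.y k)) + 0))) =
      ((‖G.rho k‖ ^ 2 : ℝ) : ℂ) * ((G.y k + star (G.y k)) / 2) := by
    push_cast
    rw [← Complex.conj_mul']
    simp
    ring
  rw [this, Complex.re_ofReal_mul]
  simp

/-- Only the loss on branch k itself is needed for strictness: it contributes |ρ|² Re y > 0 with
weight γ_L > 0, and generation costs contribute nonnegatively. -/
lemma slant_C0_pos (hG : G.Requirements) : 0 < G.slant k G.C0 := by
  have hne := hG.ac_no_loop k
  have hρ : G.rho k ≠ 0 := mul_ne_zero (star_ne_zero.2 (hG.rhoOut_ne k)) (hG.rhoIn_ne k)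
  have hy : 0 < (G.y k).re := lt_of_le_of_ne (hG.passive k) (hG.conductance_ne k).symm
  have hL : ∑ k', G.slant k (G.Ploss k') = ‖G.rho k‖ ^ 2 * (G.y k).re := by
    rw [Finset.sum_eq_single k, slant_Ploss_self k hG]
    · intro k' _ hk
      rw [slant, (branch_apply_of_not_between hne (not_between_ends k hG hk)).2.2.2.2]
      simp
    · simp
  rw [C0, slant_add, slant_smul, slant_smul, Ccost, Closs, slant_add, slant_sum, slant_sum,
    slant_sum, hL]
  simp only [slant_smul, slant_Mbus k hG, mul_zero, Finset.sum_const_zero, add_zero]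
  have h1 : 0 ≤ ∑ n, G.gamma n * G.slant k (G.P n) :=
    Finset.sum_nonneg fun n _ => mul_nonneg (hG.gamma_nonneg n) (slant_P_nonneg k hG n)
  have := hG.w_nonneg
  have := hG.gammaLoss_pos
  have := norm_pos_iff.2 hρ
  positivity

lemma Psi_src_dst_ne_zero (hG : G.Requirements) {Λ : Con N E D → ℝ} (hΛ : ∀ m, 0 ≤ Λ m) :
    G.Psi Λ (G.acSrc k) (G.acDst k) ≠ 0 := by
  intro h0
  have h1 : 0 < G.slant k (G.Psi Λ) := by
    rw [Psi, slant_add, slant_sum]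
    refine add_pos_of_pos_of_nonneg (slant_C0_pos k hG) (Finset.sum_nonneg fun m _ => ?_)
    rw [slant_smul]
    exact mul_nonneg (hΛ m) (slant_C_nonneg k hG m)
  simp [slant, h0] at h1

end HalfPlane

variable {G} in
theorem associatedGraph_Psi (hG : G.Requirements) {Λ : Con N E D → ℝ} (hΛ : ∀ m, 0 ≤ Λ m) :
    associatedGraph (G.Psi Λ) (G.Psi_isHermitian Λ) = G.acGraph := by
  ext i j
  constructor
  · rintro ⟨h, hij⟩
    by_contra hadj
    refine h ?_
    simp [Psi, Matrix.sum_apply, C0_apply_of_not_adj hG hij hadj,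
      C_apply_of_not_adj hG hij hadj]
  · intro h
    obtain ⟨k, ⟨rfl, rfl⟩ | ⟨rfl, rfl⟩⟩ := (acGraph_adj_iff hG i j).1 h
    · exact ⟨Psi_src_dst_ne_zero k hG hΛ, h.ne⟩
    · refine SimpleGraph.Adj.symm (G := associatedGraph _ (G.Psi_isHermitian Λ)) ?_
      exact ⟨Psi_src_dst_ne_zero k hG hΛ, h.ne.symm⟩

/-! ### Positive semidefinite matrices whose graph is a tree -/

/-- A kernel vector of a positive semidefinite matrix with acyclic graph that vanishes at a vertex
vanishes at its neighbors. -/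
lemma kernel_apply_eq_zero_of_adj {A : Matrix (Fin N) (Fin N) ℂ} (hA : A.PosSemidef)
    (hG : (associatedGraph A hA.isHermitian).IsAcyclic) {x : Fin N → ℂ} (hx : A *ᵥ x = 0)
    {r s : Fin N} (hrs : (associatedGraph A hA.isHermitian).Adj r s) (hr : x r = 0) :
    x s = 0 := by
  classical
  set H := associatedGraph A hA.isHermitian with hH
  have hbridge : ¬(H.deleteEdges {s(r, s)}).Reachable r s :=
    SimpleGraph.isBridge_iff.1 (SimpleGraph.isAcyclic_iff_forall_adj_isBridge.1 hG hrs)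
  -- The side of s once the bridge rs is removed; rs is the only edge leaving it.
  let B : Set (Fin N) := {i | (H.deleteEdges {s(r, s)}).Reachable i s}
  have hrB : r ∉ B := hbridge
  have hsB : s ∈ B := SimpleGraph.Reachable.refl s
  have hstep {i j : Fin N} (hij : H.Adj i j) (hne : s(i, j) ≠ s(r, s)) : i ∈ B ↔ j ∈ B := by
    have h1 : (H.deleteEdges {s(r, s)}).Adj i j := by
      rw [SimpleGraph.deleteEdges_adj]
      exact ⟨hij, hne⟩
    exact ⟨fun h => h1.symm.reachable.trans h, fun h => h1.reachable.trans h⟩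
  let z : Fin N → ℂ := fun i => if i ∈ B then x i else 0
  -- Truncation changes nothing in the rows of B: the only outside vertex they can see is r, where x
  -- vanishes.
  have hrow (i : Fin N) (hi : i ∈ B) : (A *ᵥ z) i = 0 := by
    refine Eq.trans (b := (A *ᵥ x) i) ?_ (congrFun hx i)
    change ∑ j, A i j * z j = ∑ j, A i j * x j
    refine Finset.sum_congr rfl fun j _ => ?_
    by_cases hj : j ∈ B
    · simp [z, hj]
    by_cases hAij : A i j = 0
    · simp [hAij]
    have hij : i ≠ j := by
      rintro rfl
      exact hj hi
    have hjr : j = r := by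
      by_contra hjr
      have hne : s(i, j) ≠ s(r, s) := by
        rw [Ne, Sym2.eq_iff]
        rintro (⟨h, -⟩ | ⟨-, h⟩)
        · exact hrB (h ▸ hi)
        · exact hjr h
      exact hj ((hstep ⟨hAij, hij⟩ hne).1 hi)
    simp [z, hjr, hr]
  -- Rows outside B are not yet controlled, but z vanishes there, so zᴴAz = 0; positive
  -- semidefiniteness then gives all rows.
  have hz : A *ᵥ z = 0 := by
    rw [← hA.dotProduct_mulVec_zero_iff]
    refine Finset.sum_eq_zero fun i _ => ?_
    by_cases hi : i ∈ B
    · rw [hrow i hi, mul_zero]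
    · simp [z, hi]
  have h1 : A r s * x s = 0 := by
    -- Row r, which lies outside B, sees only s inside B.
    have h2 : (A *ᵥ z) r = A r s * z s := by
      refine Finset.sum_eq_single s (fun j _ hjs => ?_)
        fun h => absurd (Finset.mem_univ s) h
      change A r j * z j = 0
      by_cases hj : j ∈ B
      · by_cases hAj : A r j = 0
        · simp [hAj]
        have hrj : r ≠ j := by
          rintro rfl
          exact hrB hj
        have hne : s(r, j) ≠ s(r, s) := by
          rw [Ne, Sym2.eq_iff]
          rintro (⟨-, h⟩ | ⟨-, h⟩)
          · exact hjs h
          · exact hrj h.symm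
        exact absurd ((hstep ⟨hAj, hrj⟩ hne).2 hj) hrB
      · simp [z, hj]
    rw [hz] at h2
    simpa [z, hsB] using h2.symm
  exact (mul_eq_zero.1 h1).resolve_left hrs.1

/-- Zeros of a kernel vector spread along walks from any root r, so evaluation at r is injective on
the kernel, which thus has dimension at most one. -/
theorem le_rank_add_one_of_isTree {A : Matrix (Fin N) (Fin N) ℂ} (hA : A.PosSemidef)
    (hG : (associatedGraph A hA.isHermitian).IsTree) : N ≤ A.rank + 1 := by
  obtain ⟨r⟩ := hG.1.nonempty
  have hker (x : Fin N → ℂ) (hx : A *ᵥ x = 0) (hr : x r = 0) : x = 0 := by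
    funext s
    obtain ⟨W⟩ := hG.1.preconnected r s
    induction W with
    | nil => exact hr
    | cons hadj _ ih => exact ih (kernel_apply_eq_zero_of_adj hA hG.2 hx hadj hr)
  have hinj : Function.Injective
      ((LinearMap.proj (R := ℂ) (φ := fun _ : Fin N => ℂ) r).domRestrict
        (LinearMap.ker A.mulVecLin)) := by
    rw [← LinearMap.ker_eq_bot, LinearMap.ker_eq_bot']
    rintro ⟨x, hx⟩ h0
    exact Subtype.ext (hker x hx h0)
  have h1 := LinearMap.finrank_le_finrank_of_injective hinj
  have h2 := A.mulVecLin.finrank_range_add_finrank_ker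
  rw [Module.finrank_self] at h1
  rw [Module.finrank_fin_fun] at h2
  change A.rank + _ = N at h2
  omega

/-! ### Lagrange multipliers -/

/-- Lagrange multipliers of a convex program under Slater's condition. -/
theorem exists_multipliers {ι X : Type*} [Fintype ι] [AddCommGroup X] [Module ℝ X] {s : Set X}
    {f : X → ℝ} {g : ι → X → ℝ} (hf : ConvexOn ℝ s f) (hg : ∀ i, ConvexOn ℝ s (g i))
    {x₀ : X} (hx₀ : x₀ ∈ s) (hgx₀ : ∀ i, g i x₀ < 0) {a : ℝ}
    (ha : ∀ x ∈ s, (∀ i, g i x ≤ 0) → a ≤ f x) :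
    ∃ μ : ι → ℝ, (∀ i, 0 ≤ μ i) ∧ ∀ x ∈ s, a ≤ f x + ∑ i, μ i * g i x := by
  classical
  -- Strict inequalities make K open without any continuity of f or g; (0, a) lies outside K, so a
  -- hyperplane separates them.
  let K : Set ((ι → ℝ) × ℝ) := {u | ∃ x ∈ s, (∀ i, g i x < u.1 i) ∧ f x < u.2}
  have hKo : IsOpen K := by
    have : K = ⋃ x ∈ s, {u : (ι → ℝ) × ℝ | (∀ i, g i x < u.1 i) ∧ f x < u.2} := by
      ext u
      simp only [K, Set.mem_iUnion, Set.mem_ofPred_eq, exists_prop]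
    rw [this]
    refine isOpen_biUnion fun x _ => ?_
    simp only [Set.ofPred_and, Set.ofPred_forall]
    exact (isOpen_iInter_of_finite fun i => isOpen_lt (by fun_prop) (by fun_prop)).inter
      (isOpen_lt (by fun_prop) (by fun_prop))
  have hKc : Convex ℝ K := by
    have hlt {p q p' q' c d : ℝ} (h : p < p') (h' : q < q') (hc : 0 ≤ c) (hd : 0 ≤ d)
        (hcd : c + d = 1) : c * p + d * q < c * p' + d * q' := by
      rcases hc.eq_or_lt with rfl | hc
      · obtain rfl : d = 1 := by linarith
        linarith
      · nlinarith [mul_le_mul_of_nonneg_left h'.le hd, mul_lt_mul_of_pos_left h hc]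
    rintro u ⟨x, hx, hgx, hfx⟩ u' ⟨x', hx', hgx', hfx'⟩ c d hc hd hcd
    refine ⟨c • x + d • x', hf.1 hx hx' hc hd hcd, fun i => ?_, ?_⟩
    · exact ((hg i).2 hx hx' hc hd hcd).trans_lt (hlt (hgx i) (hgx' i) hc hd hcd)
    · exact (hf.2 hx hx' hc hd hcd).trans_lt (hlt hfx hfx' hc hd hcd)
  have hKa : ((0 : ι → ℝ), a) ∉ K := by
    rintro ⟨x, hx, hgx, hfx⟩
    exact (ha x hx fun i => (hgx i).le).not_gt hfx
  obtain ⟨φ, hφ⟩ := geometric_hahn_banach_open_point hKc hKo hKa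
  have hφe (u : ι → ℝ) (t : ℝ) :
      φ (u, t) = ∑ i, u i * φ (Pi.single i 1, 0) + t * φ (0, 1) := by
    have h1 : ((u, t) : (ι → ℝ) × ℝ) =
        ∑ i, u i • ((Pi.single i (1 : ℝ) : ι → ℝ), (0 : ℝ)) + t • ((0 : ι → ℝ), (1 : ℝ)) := by
      ext j
      · simp [Prod.fst_sum, Finset.sum_apply, Pi.single_apply]
      · simp [Prod.snd_sum]
    rw [h1, map_add, map_sum]
    simp only [map_smul, smul_eq_mul]
  have h0 : φ (0, a) = a * φ (0, 1) := by
    rw [hφe]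
    simp only [Pi.zero_apply, zero_mul, Finset.sum_const_zero, zero_add]
  have hfx₀ : a ≤ f x₀ := ha x₀ hx₀ fun i => (hgx₀ i).le
  -- Slater's condition rules out a vertical hyperplane: the strictly feasible x₀ puts a point of K
  -- directly above (0, a).
  have hτ : φ (0, 1) < 0 := by
    have h1 := hφ (0, f x₀ + 1) ⟨x₀, hx₀, hgx₀, by simp⟩
    rw [h0, hφe] at h1
    simp only [Pi.zero_apply, zero_mul, Finset.sum_const_zero, zero_add] at h1
    nlinarith
  have hμ (i : ι) : φ (Pi.single i 1, 0) ≤ 0 := by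
    by_contra! hpos
    -- Chosen so that φ at (r eᵢ, f x₀ + 1) equals φ(0, a), against strict separation.
    let r : ℝ := (-(f x₀ + 1 - a) * φ (0, 1)) / φ (Pi.single i 1, 0)
    have hr : 0 ≤ r := div_nonneg (by nlinarith) hpos.le
    have h1 := hφ (Pi.single i r, f x₀ + 1) ⟨x₀, hx₀, fun j => by
      refine (hgx₀ j).trans_le ?_
      by_cases hj : j = i
      · subst hj
        simpa using hr
      · simp [hj], by simp⟩
    rw [h0, hφe] at h1
    rw [Finset.sum_eq_single i (fun j _ hj => by rw [Pi.single_eq_of_ne hj, zero_mul])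
      fun h => absurd (Finset.mem_univ i) h, Pi.single_eq_same] at h1
    have h2 : r * φ (Pi.single i 1, 0) = -(f x₀ + 1 - a) * φ (0, 1) := div_mul_cancel₀ _ hpos.ne'
    linarith
  refine ⟨fun i => φ (Pi.single i 1, 0) / φ (0, 1),
    fun i => div_nonneg_of_nonpos (hμ i) hτ.le, fun x hx => ?_⟩
  have hle : ∑ i, g i x * φ (Pi.single i 1, 0) + f x * φ (0, 1) ≤ a * φ (0, 1) := by
    -- The point (g x, f x) itself is not in K; it is reached as a limit of points raised by ε > 0,
    -- at the price of a weak inequality.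
    have hcont : Continuous fun ε : ℝ => φ ((fun i => g i x + ε), f x + ε) := by fun_prop
    have h1 : φ ((fun i => g i x + 0), f x + 0) ≤ φ (0, a) := by
      refine le_of_tendsto (hcont.tendsto 0 |>.mono_left (nhdsWithin_le_nhds (s := Set.Ioi 0))) ?_
      filter_upwards [self_mem_nhdsWithin] with ε hε
      exact (hφ _ ⟨x, hx, fun i => by simpa using hε, by simpa using hε⟩).le
    rw [h0, hφe] at h1
    simpa only [add_zero] using h1
  have h2 : ∑ i, φ (Pi.single i 1, 0) / φ (0, 1) * g i x =
      (∑ i, g i x * φ (Pi.single i 1, 0)) / φ (0, 1) := by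
    rw [Finset.sum_div]
    exact Finset.sum_congr rfl fun i _ => by ring
  rw [h2, ← sub_le_iff_le_add', le_div_iff_of_neg hτ]
  linarith

/-! ### The semidefinite relaxation -/

section Trace

lemma trace_mul_vecMulVec (A : Matrix (Fin N) (Fin N) ℂ) (v : Fin N → ℂ) :
    (A * Matrix.vecMulVec v (star v)).trace = star v ⬝ᵥ A *ᵥ v := by
  rw [Matrix.mul_vecMulVec, Matrix.trace_vecMulVec, dotProduct_comm]

lemma re_trace_mul_vecMulVec (A : Matrix (Fin N) (Fin N) ℂ) (v : Fin N → ℂ) :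
    (A * Matrix.vecMulVec v (star v)).trace.re = quad A v := by
  rw [trace_mul_vecMulVec, quad]

lemma relaxedFeasible_vecMulVec_iff (v : Fin N → ℂ) (p : Fin D → ℝ) :
    G.RelaxedFeasible (Matrix.vecMulVec v (star v)) p ↔ G.OPFFeasible v p := by
  simp only [RelaxedFeasible, OPFFeasible, re_trace_mul_vecMulVec,
    Matrix.posSemidef_vecMulVec_self_star, true_and]

/-- Complementary positive semidefinite matrices annihilate each other. -/
lemma mul_eq_zero_of_re_trace_nonpos {A V : Matrix (Fin N) (Fin N) ℂ} (hA : A.PosSemidef)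
    (hV : V.PosSemidef) (h : (A * V).trace.re ≤ 0) : A * V = 0 := by
  -- Each rank-one piece contributes xᴴAx ≥ 0 to the trace, so each of these values is zero, and
  -- then Ax = 0.
  obtain ⟨m, x, rfl⟩ := Matrix.posSemidef_iff_eq_sum_vecMulVec.1 hV
  rw [Matrix.mul_sum, Matrix.trace_sum, Complex.re_sum] at h
  have hnn (i : Fin m) : 0 ≤ star (x i) ⬝ᵥ A *ᵥ x i := hA.dotProduct_mulVec_nonneg _
  have hz : ∑ i, (A * Matrix.vecMulVec (x i) (star (x i))).trace.re = 0 :=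
    h.antisymm (Finset.sum_nonneg fun i _ => by
      rw [trace_mul_vecMulVec]
      exact (Complex.nonneg_iff.1 (hnn i)).1)
  rw [Finset.sum_eq_zero_iff_of_nonneg fun i _ => by
    rw [trace_mul_vecMulVec]
    exact (Complex.nonneg_iff.1 (hnn i)).1] at hz
  rw [Matrix.mul_sum]
  refine Finset.sum_eq_zero fun i hi => ?_
  have h1 := hz i hi
  rw [trace_mul_vecMulVec] at h1
  have h2 : star (x i) ⬝ᵥ A *ᵥ x i = 0 :=
    Complex.ext h1 (Complex.nonneg_iff.1 (hnn i)).2.symm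
  rw [Matrix.mul_vecMulVec, (hA.dotProduct_mulVec_zero_iff _).1 h2, Matrix.zero_vecMulVec]

/-- AM-GM on each rank-one piece. The diagonal controls all entries, which gives boundedness of the
feasible set. -/
lemma norm_apply_le_of_posSemidef {V : Matrix (Fin N) (Fin N) ℂ} (hV : V.PosSemidef)
    (i j : Fin N) : ‖V i j‖ ≤ ((V i i).re + (V j j).re) / 2 := by
  obtain ⟨m, x, rfl⟩ := Matrix.posSemidef_iff_eq_sum_vecMulVec.1 hV
  simp only [Matrix.sum_apply, Matrix.vecMulVec_apply, Pi.star_apply, Complex.re_sum]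
  have hd (k : Fin N) (l : Fin m) : (x l k * star (x l k)).re = ‖x l k‖ ^ 2 := by
    rw [Complex.star_def, Complex.mul_conj']
    norm_cast
  simp only [hd]
  rw [← Finset.sum_add_distrib, Finset.sum_div]
  refine (norm_sum_le _ _).trans (Finset.sum_le_sum fun l _ => ?_)
  rw [norm_mul, norm_star]
  nlinarith [sq_nonneg (‖x l i‖ - ‖x l j‖)]

/-- A positive semidefinite matrix of rank at most one is the square of a vector. -/
lemma exists_eq_vecMulVec {V : Matrix (Fin N) (Fin N) ℂ} (hV : V.PosSemidef) (hr : V.rank ≤ 1) :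
    ∃ v : Fin N → ℂ, V = Matrix.vecMulVec v (star v) := by
  by_cases h0 : ∀ i, V i i = 0
  · refine ⟨0, ?_⟩
    ext i j
    have := norm_apply_le_of_posSemidef hV i j
    simpa [h0] using this
  push Not at h0
  obtain ⟨i, hi⟩ := h0
  have hpos : 0 < V i i := lt_of_le_of_ne hV.diag_nonneg hi.symm
  obtain ⟨hre, him⟩ := Complex.pos_iff.1 hpos
  have hVi : V i i = ((V i i).re : ℂ) := Complex.ext rfl him.symm
  -- All columns are multiples of one vector w, so the 2×2 minors vanish.
  have hminor (j k : Fin N) : V j k * V i i = V j i * V i k := by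
    obtain ⟨w, hw⟩ := finrank_le_one_iff.1 hr
    have hcol (l : Fin N) : ∃ c : ℂ, ∀ a, V a l = c * (w : Fin N → ℂ) a := by
      obtain ⟨c, hc⟩ := hw ⟨V *ᵥ Pi.single l 1, Pi.single l 1, rfl⟩
      refine ⟨c, fun a => ?_⟩
      have := congrFun (congrArg Subtype.val hc) a
      simpa using this.symm
    obtain ⟨c, hc⟩ := hcol k
    obtain ⟨d, hd⟩ := hcol i
    rw [hc j, hd i, hd j, hc i]
    ring
  -- Column i, rescaled so that its i-th coordinate becomes √(V i i).
  refine ⟨fun j => V j i / (Real.sqrt (V i i).re : ℂ), ?_⟩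
  ext j k
  have hs : ((Real.sqrt (V i i).re : ℂ)) * (Real.sqrt (V i i).re : ℂ) = V i i := by
    rw [← Complex.ofReal_mul, Real.mul_self_sqrt hre.le, ← hVi]
  rw [Matrix.vecMulVec_apply, Pi.star_apply, star_div₀, hV.isHermitian.apply, Complex.star_def,
    Complex.conj_ofReal, div_mul_div_comm, hs, ← hminor, mul_div_cancel_right₀ _ hi]

end Trace

/-! ### Compactness and existence of an optimizer -/

lemma isClosed_posSemidef : IsClosed {V : Matrix (Fin N) (Fin N) ℂ | V.PosSemidef} := by
  simp only [Matrix.posSemidef_iff_dotProduct_mulVec, Set.ofPred_and, Set.ofPred_forall]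
  refine IsClosed.inter ?_ (isClosed_iInter fun x => ?_)
  · exact isClosed_eq (by fun_prop) continuous_id
  · exact isClosed_le continuous_const (by fun_prop)

lemma continuous_re_trace_add_dotProduct (A : Matrix (Fin N) (Fin N) ℂ) (q : Fin D → ℝ) :
    Continuous fun x : Matrix (Fin N) (Fin N) ℂ × (Fin D → ℝ) =>
      (A * x.1).trace.re + q ⬝ᵥ x.2 := by
  fun_prop

/-- The upper voltage bounds control the diagonal of V and thereby all its entries; the DC bounds
confine p to a box. -/
lemma isCompact_relaxedFeasible :
    IsCompact {x : Matrix (Fin N) (Fin N) ℂ × (Fin D → ℝ) | G.RelaxedFeasible x.1 x.2} := by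
  let R : ℝ := ∑ n, G.Vmax n ^ 2
  have hcl : IsClosed {x : Matrix (Fin N) (Fin N) ℂ × (Fin D → ℝ) |
      G.RelaxedFeasible x.1 x.2} := by
    simp only [RelaxedFeasible, Set.ofPred_and, Set.ofPred_forall]
    exact (isClosed_posSemidef.preimage continuous_fst).inter (isClosed_iInter fun m =>
      isClosed_le (continuous_re_trace_add_dotProduct _ _) continuous_const)
  let B : Set (Matrix (Fin N) (Fin N) ℂ) :=
    Set.pi Set.univ fun _ => Set.pi Set.univ fun _ => Metric.closedBall (0 : ℂ) R
  have hB : IsCompact B :=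
    isCompact_univ_pi fun _ => isCompact_univ_pi fun _ => isCompact_closedBall _ _
  refine (hB.prod (isCompact_Icc (a := G.pMin) (b := G.pMax))).of_isClosed_subset hcl ?_
  rintro ⟨V, p⟩ ⟨hV, hc⟩
  have hdiag (n : Fin N) : (V n n).re ≤ R := by
    have h1 : (V n n).re ≤ G.Vmax n ^ 2 := by
      simpa [C, c, b, Mbus, Matrix.trace_single_mul] using hc (.voltMax n)
    exact h1.trans (Finset.single_le_sum (f := fun n => G.Vmax n ^ 2)
      (fun _ _ => sq_nonneg _) (Finset.mem_univ n))
  refine ⟨fun i _ j _ => ?_, fun l => ?_, fun l => ?_⟩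
  · rw [mem_closedBall_zero_iff]
    have := norm_apply_le_of_posSemidef hV i j
    linarith [hdiag i, hdiag j]
  · simpa [C, c, b] using hc (.dcMin l)
  · simpa [C, c, b] using hc (.dcMax l)

variable {G} in
lemma EssentiallyStrictlyFeasible.exists_feasible (h : G.EssentiallyStrictlyFeasible) :
    ∃ v p, G.OPFFeasible v p := by
  obtain ⟨v, p, -, h⟩ := h
  refine ⟨v, p, fun m => ?_⟩
  have hm := h m
  cases m with
  | dcMax l => simpa [C, c, b, quad] using hm
  | dcMin l => simpa [C, c, b, quad] using hm
  | _ => exact hm.le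

variable {G} in
theorem exists_relaxedOptimizer (h : G.EssentiallyStrictlyFeasible) :
    ∃ V p, G.RelaxedOptimizer V p := by
  obtain ⟨v, p, hvp⟩ := h.exists_feasible
  obtain ⟨x, hx, hmin⟩ := G.isCompact_relaxedFeasible.exists_isMinOn
    ⟨(Matrix.vecMulVec v (star v), p), (G.relaxedFeasible_vecMulVec_iff v p).2 hvp⟩
    (continuous_re_trace_add_dotProduct G.C0 G.c0).continuousOn
  exact ⟨x.1, x.2, hx, fun V' p' h' => isMinOn_iff.1 hmin (V', p') h'⟩

/-! ### Duality for the relaxed problem -/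

/-- The constraints as convex functions, with those on single DC branches replaced by a trivial
one. -/
noncomputable def slack (m : Con N E D) (x : Matrix (Fin N) (Fin N) ℂ × (Fin D → ℝ)) : ℝ :=
  match m with
  | .dcMax _ => -1
  | .dcMin _ => -1
  | m => (G.C m * x.1).trace.re + G.c m ⬝ᵥ x.2 - G.b m

/-- The positive semidefinite matrices together with the flows within their bounds. -/
def relaxedDomain : Set (Matrix (Fin N) (Fin N) ℂ × (Fin D → ℝ)) :=
  {V | V.PosSemidef} ×ˢ Set.Icc G.pMin G.pMax

lemma convex_relaxedDomain : Convex ℝ G.relaxedDomain := by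
  refine Convex.prod ?_ (convex_Icc _ _)
  intro V hV V' hV' a b ha hb _
  exact (hV.smul ha).add (hV'.smul hb)

lemma convexOn_affine {s : Set (Matrix (Fin N) (Fin N) ℂ × (Fin D → ℝ))} (hs : Convex ℝ s)
    (A : Matrix (Fin N) (Fin N) ℂ) (q : Fin D → ℝ) (r : ℝ) :
    ConvexOn ℝ s fun x => (A * x.1).trace.re + q ⬝ᵥ x.2 - r := by
  refine ⟨hs, fun x _ y _ a b _ _ hab => le_of_eq ?_⟩
  simp only [Prod.fst_add, Prod.snd_add, Prod.smul_fst, Prod.smul_snd, Matrix.mul_add,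
    Matrix.mul_smul, Matrix.trace_add, Matrix.trace_smul, Complex.add_re, Complex.smul_re,
    dotProduct_add, dotProduct_smul, smul_eq_mul]
  linear_combination r * hab

lemma convexOn_slack (m : Con N E D) : ConvexOn ℝ G.relaxedDomain (G.slack m) := by
  cases m with
  | dcMax l => exact convexOn_const _ G.convex_relaxedDomain
  | dcMin l => exact convexOn_const _ G.convex_relaxedDomain
  | _ => exact convexOn_affine G.convex_relaxedDomain _ _ _

/-- The DC bounds move into the domain because they may hold with equality at the Slater point; the
constant slack -1 left in their place is strict. Their multipliers do not affect Ψ, since their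
matrices are zero. -/
lemma relaxedFeasible_iff (V : Matrix (Fin N) (Fin N) ℂ) (p : Fin D → ℝ) :
    G.RelaxedFeasible V p ↔ (V, p) ∈ G.relaxedDomain ∧ ∀ m, G.slack m (V, p) ≤ 0 := by
  constructor
  · rintro ⟨hV, hc⟩
    refine ⟨⟨hV, fun l => ?_, fun l => ?_⟩, fun m => ?_⟩
    · simpa [C, c, b] using hc (.dcMin l)
    · simpa [C, c, b] using hc (.dcMax l)
    · have := hc m
      cases m <;> simp only [slack] <;> linarith
  · rintro ⟨⟨hV, hp, hp'⟩, hs⟩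
    refine ⟨hV, fun m => ?_⟩
    have := hs m
    cases m with
    | dcMax l => simpa [C, c, b] using hp' l
    | dcMin l => simpa [C, c, b] using hp l
    | _ => exact sub_nonpos.1 this

lemma re_trace_Psi_mul (Λ : Con N E D → ℝ) (V : Matrix (Fin N) (Fin N) ℂ) :
    (G.Psi Λ * V).trace.re = (G.C0 * V).trace.re + ∑ m, Λ m * (G.C m * V).trace.re := by
  simp only [Psi, Matrix.add_mul, Matrix.trace_add, Complex.add_re, Matrix.sum_mul,
    Matrix.trace_sum, Complex.re_sum, Matrix.smul_mul, Matrix.trace_smul, smul_eq_mul,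
    Complex.re_ofReal_mul]

lemma slack_sub_slack (m : Con N E D) (V V' : Matrix (Fin N) (Fin N) ℂ) (p : Fin D → ℝ) :
    G.slack m (V', p) - G.slack m (V, p) = (G.C m * V').trace.re - (G.C m * V).trace.re := by
  cases m <;> simp [slack, C]

variable {G} in
/-- Dual multipliers for an optimizer of the relaxed problem, with complementary slackness. -/
theorem RelaxedOptimizer.exists_dual (h : G.EssentiallyStrictlyFeasible)
    {V : Matrix (Fin N) (Fin N) ℂ} {p : Fin D → ℝ} (hopt : G.RelaxedOptimizer V p) :
    ∃ Λ : Con N E D → ℝ, (∀ m, 0 ≤ Λ m) ∧ (G.Psi Λ).PosSemidef ∧ G.Psi Λ * V = 0 := by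
  obtain ⟨hfeas, hmin⟩ := hopt
  have hslack := ((G.relaxedFeasible_iff V p).1 hfeas).2
  have hdom := ((G.relaxedFeasible_iff V p).1 hfeas).1
  have hV : V.PosSemidef := hfeas.1
  obtain ⟨v₀, p₀, hfeas₀, hlt₀⟩ : ∃ v₀ p₀, G.OPFFeasible v₀ p₀ ∧
      ∀ m, G.slack m (Matrix.vecMulVec v₀ (star v₀), p₀) < 0 := by
    have h' := h
    obtain ⟨v₀, p₀, -, h₀⟩ := h'
    refine ⟨v₀, p₀, fun m => ?_, fun m => ?_⟩
    · have hm := h₀ m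
      cases m with
      | dcMax l => simpa [C, c, b, quad] using hm
      | dcMin l => simpa [C, c, b, quad] using hm
      | _ => exact hm.le
    · have hm := h₀ m
      cases m with
      | dcMax l => simp [slack]
      | dcMin l => simp [slack]
      | _ =>
        simp only [slack, re_trace_mul_vecMulVec]
        exact sub_neg.2 hm
  have hdom₀ := ((G.relaxedFeasible_iff _ _).1
    ((G.relaxedFeasible_vecMulVec_iff v₀ p₀).2 hfeas₀)).1
  -- The `- 0` matches the shape of `convexOn_affine` with zero constant.
  obtain ⟨Λ, hΛ, hle⟩ := exists_multipliers (a := (G.C0 * V).trace.re + G.c0 ⬝ᵥ p - 0)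
    (convexOn_affine G.convex_relaxedDomain G.C0 G.c0 0) G.convexOn_slack hdom₀ hlt₀
    fun x hx hgx => by simpa using hmin x.1 x.2 ((G.relaxedFeasible_iff _ _).2 ⟨hx, hgx⟩)
  -- With p kept fixed, the terms in p and b cancel, so V minimizes tr(Ψ ·) over the whole positive
  -- semidefinite cone. Comparison with 0 and with 2V then forces tr(ΨV) = 0, and comparison with
  -- xxᴴ gives Ψ ⪰ 0.
  have hmono (V' : Matrix (Fin N) (Fin N) ℂ) (hV' : V'.PosSemidef) :
      (G.Psi Λ * V).trace.re ≤ (G.Psi Λ * V').trace.re := by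
    have h1 := hle (V', p) ⟨hV', hdom.2⟩
    have h2 : ∑ m, Λ m * G.slack m (V, p) ≤ 0 :=
      Finset.sum_nonpos fun m _ => mul_nonpos_of_nonneg_of_nonpos (hΛ m) (hslack m)
    have h3 : ∑ m, Λ m * G.slack m (V', p) - ∑ m, Λ m * G.slack m (V, p) =
        ∑ m, Λ m * (G.C m * V').trace.re - ∑ m, Λ m * (G.C m * V).trace.re := by
      rw [← Finset.sum_sub_distrib, ← Finset.sum_sub_distrib]
      refine Finset.sum_congr rfl fun m _ => ?_
      rw [← mul_sub, ← mul_sub, slack_sub_slack]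
    rw [re_trace_Psi_mul, re_trace_Psi_mul]
    dsimp only at h1
    linarith
  have hV0 : (G.Psi Λ * V).trace.re ≤ 0 := by
    simpa using hmono 0 Matrix.PosSemidef.zero
  have hV0' : 0 ≤ (G.Psi Λ * V).trace.re := by
    have h1 := hmono (V + V) (hV.add hV)
    rw [Matrix.mul_add, Matrix.trace_add, Complex.add_re] at h1
    linarith
  have hΨ : (G.Psi Λ).PosSemidef := by
    refine Matrix.PosSemidef.of_dotProduct_mulVec_nonneg (G.Psi_isHermitian Λ) fun x => ?_
    rw [Complex.nonneg_iff]
    refine ⟨?_, ?_⟩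
    · rw [← trace_mul_vecMulVec]
      exact hV0'.trans (hmono _ (Matrix.posSemidef_vecMulVec_self_star x))
    · exact ((G.Psi_isHermitian Λ).im_star_dotProduct_mulVec_self x).symm
  exact ⟨Λ, hΛ, hΨ, mul_eq_zero_of_re_trace_nonpos hΨ hV hV0⟩

end HybridGrid

/-! ### Exactness of the relaxation -/

theorem mainTheorem1 {N E D : ℕ} (G : HybridGrid N E D) (hG : G.Requirements) :
    (∀ Λ : HybridGrid.Con N E D → ℝ, (∀ m, 0 ≤ Λ m) →
      HybridGrid.associatedGraph (G.Psi Λ) (G.Psi_isHermitian Λ) = G.acGraph ∧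
      ((G.Psi Λ).PosSemidef → N ≤ (G.Psi Λ).rank + 1)) ∧
    (G.EssentiallyStrictlyFeasible →
      (∃ V p, G.RelaxedOptimizer V p) ∧
      ∀ V p, G.RelaxedOptimizer V p →
        V.rank ≤ 1 ∧
        ((∀ q, ¬ G.OPFFeasible 0 q) → V.rank = 1) ∧
        (∃ v : Fin N → ℂ, V = Matrix.vecMulVec v (star v)) ∧
        ∀ v : Fin N → ℂ, V = Matrix.vecMulVec v (star v) → G.OPFOptimizer v p) := by
  have ha (Λ : HybridGrid.Con N E D → ℝ) (hΛ : ∀ m, 0 ≤ Λ m) :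
      HybridGrid.associatedGraph (G.Psi Λ) (G.Psi_isHermitian Λ) = G.acGraph ∧
      ((G.Psi Λ).PosSemidef → N ≤ (G.Psi Λ).rank + 1) := by
    have h1 := HybridGrid.associatedGraph_Psi hG hΛ
    exact ⟨h1, fun hΨ => HybridGrid.le_rank_add_one_of_isTree hΨ (h1 ▸ hG.tree)⟩
  refine ⟨ha, fun h => ⟨HybridGrid.exists_relaxedOptimizer h, fun V p hopt => ?_⟩⟩
  obtain ⟨Λ, hΛ, hΨ, hmul⟩ := hopt.exists_dual h
  have hrank : V.rank ≤ 1 := by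
    have h1 := Matrix.rank_add_rank_le_card_of_mul_eq_zero hmul
    rw [Fintype.card_fin] at h1
    have h2 := (ha Λ hΛ).2 hΨ
    omega
  refine ⟨hrank, fun h0 => ?_, HybridGrid.exists_eq_vecMulVec hopt.1.1 hrank, ?_⟩
  -- Rank zero would mean V = 0, making (0, p) feasible for the OPF problem.
  · refine hrank.antisymm (Nat.one_le_iff_ne_zero.2 fun hr => h0 p ?_)
    have hV : V = 0 := Matrix.toLin'.injective
      ((LinearMap.range_eq_bot.1 (Submodule.finrank_eq_zero.1 hr)).trans (map_zero _).symm)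
    rw [← G.relaxedFeasible_vecMulVec_iff]
    simpa [hV] using hopt.1
  · rintro v rfl
    refine ⟨(G.relaxedFeasible_vecMulVec_iff v p).1 hopt.1, fun v' p' h' => ?_⟩
    have h1 := hopt.2 _ _ ((G.relaxedFeasible_vecMulVec_iff v' p').2 h')
    rwa [HybridGrid.re_trace_mul_vecMulVec, HybridGrid.re_trace_mul_vecMulVec] at h1
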